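/- Let $T^*\mathfrak h_3=\mathfrak h_3\ltimes_{\mathrm{ad}^*}\mathfrak h_3^*$ be the cotangent algebra of the Heisenberg algebra $\mathfrak h_3$ ($[x_1,x_2]=x_3$), and $\mathfrak g'$ its derived algebra. Call a basis $(e_1,\dots,e_6)$ of $T^*\mathfrak h_3$ adapted if its only nonzero commutators (up to antisymmetry) are $[e_1,e_2]=e_6$, $[e_1,e_3]=-e_5$, $[e_2,e_3]=e_4$. A left invariant metric is a nondegenerate symmetric bilinear form $\langle\cdot,\cdot\rangle$ of any signature on $T^*\mathfrak h_3$. Its Levi-Civita connection is given on left invariant fields by $$2\langle\nabla_xy,z\rangle=\langle[x,y],z\rangle-\langle[y,z],x\rangle+\langle[z,x],y\rangle ,$$ and $R(x,y)=\nabla_x\nabla_y-\nabla_y\nabla_x-\nabla_{[x,y]}$, $\rho(x,y)=\mathrm{Tr}(z\mapsto R(z,x)y)$. The metric is flat if $R=0$, locally symmetric if $\nabla R=0$, Ricci-flat if $\rho=0$, Ricci-parallel if $\nabla\rho=0$, and Einstein if $\rho=c\,\langle\cdot,\cdot\rangle$ for some $c\in\mathbb R$. Write $(S,M,E)$ for a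 metric whose matrix in some adapted basis is $\begin{pmatrix}S&M\\M^T&E\end{pmatrix}$ with $3\times3$ blocks, and put $E_{20}=\mathrm{diag}(0,1,1)$, $E_{11}=\mathrm{diag}(0,1,-1)$, $E_{10}=\mathrm{diag}(0,0,1)$, $M_0=\mathrm{diag}(1,0,0)$. Below, all parameters are real and such that the matrix of the metric is nondegenerate. (i) If the restriction of the metric to $\mathfrak g'$ is nondegenerate, then the metric is neither flat nor Ricci-flat. (ii) ($\mathfrak g'$ degenerate of rank 2.) The following metrics are Ricci-parallel, and they are Ricci-flat exactly under the stated condition: - $(\mathrm{diag}(0,s_{22},s_{33}),M_0,\varepsilon E_{20})$, $\varepsilon\in\{1,-1\}$; Ricci-flat iff $s_{33}=\varepsilon-s_{22}$; - $(\mathrm{diag}(0,s_{22},s_{33}),M_0,E_{11})$; Ricci-flat iff $s_{33}=-1+s_{22}$; - $\left(\begin{pmatrix}0&0&0\\0&s_{22}&\frac12|s_{22}|\\0&\frac12|s_{22}|&0\end{pmatrix},M_0,E_{11}\right)$; Ricci-flat iff $s_{22}=1$; - $\left(\begin{pmatrix}0&0&0\\0&0&\frac12|s_{33}|\\0&\frac12|s_{33}|&s_{33}\end{pmatrix},M_0,E_{11}\right)$;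 Ricci-flat iff $s_{33}=-1$. (iii) ($\mathfrak g'$ degenerate of rank 1.) Let $\varepsilon,\eta\in\{1,-1\}$. The metrics $(\varepsilon E_{10},M,\eta E_{10})$ with $M$ one of $$\begin{pmatrix}m_{11}&0&0\\0&m_{22}&0\\0&0&0\end{pmatrix},\quad\begin{pmatrix}m_{11}&m_{12}&0\\-m_{12}&m_{11}&0\\0&0&0\end{pmatrix},\quad\begin{pmatrix}m_{11}&0&0\\1&m_{11}&0\\0&0&0\end{pmatrix}$$ are locally symmetric and Ricci-flat. With the first form of $M$ the metric is flat iff $\varepsilon=\eta$ and $m_{11}=m_{22}\pm\sqrt3$; with the second form it is flat iff $\varepsilon=-\eta$ and $m_{12}=\pm\frac{\sqrt3}2$; with the third form it is never flat. The metrics $(\varepsilon E_{10},M,\eta E_{10})$ with $$M=\begin{pmatrix}0&\lambda&0\\1&0&0\\1&0&0\end{pmatrix}$$ are Ricci-parallel and not Ricci-flat. (iv) If the restriction of the metric to $\mathfrak g'$ has rank 0, then the metric is flat. (v) A left invariant metric on $T^*\mathfrak h_3$ is Einstein if and only if it is Ricci-flat. -/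

import Mathlib

/-!
Left invariant pseudo-Riemannian metrics on a simply connected Lie group correspond to nondegenerate
symmetric bilinear forms on its Lie algebra; the Levi-Civita connection and all the curvature tensors
are determined by their values on left invariant vector fields, that is, on the Lie algebra.
-/

/-! ### Metric Lie algebras -/

section MetricLieAlgebra

/-- A left invariant pseudo-Riemannian metric (of arbitrary signature): a nondegenerate symmetric
bilinear form on the Lie algebra. -/
structure LeftInvMetric (g : Type*) [LieRing g] [LieAlgebra ℝ g] where
  /-- the inner product of left invariant vector fields -/
  form : LinearMap.BilinForm ℝ g
  symm : form.IsSymm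
  nondeg : form.Nondegenerate

namespace LeftInvMetric

variable {g : Type*} [LieRing g] [LieAlgebra ℝ g] [FiniteDimensional ℝ g]

/-- The right-hand side of Koszul's formula on left invariant fields, as a linear form in `z`:
`⟨[x,y],z⟩ - ⟨[y,z],x⟩ + ⟨[z,x],y⟩`. -/
def koszul (m : LeftInvMetric g) (x y : g) : Module.Dual ℝ g where
  toFun z := m.form ⁅x, y⁆ z - m.form ⁅y, z⁆ x + m.form ⁅z, x⁆ y
  map_add' z w := by simp only [map_add, lie_add, add_lie, LinearMap.add_apply]; ring
  map_smul' c z := by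
    simp only [map_smul, lie_smul, smul_lie, LinearMap.smul_apply, smul_eq_mul, RingHom.id_apply]
    ring

/-- The Levi-Civita connection on left invariant fields: `nabla x y` is the vector `∇ₓ y` determined
by Koszul's formula `2 ⟨∇ₓ y, z⟩ = ⟨[x,y],z⟩ - ⟨[y,z],x⟩ + ⟨[z,x],y⟩` for all `z`. -/
noncomputable def nabla (m : LeftInvMetric g) : g →ₗ[ℝ] g →ₗ[ℝ] g :=
  LinearMap.mk₂ ℝ (fun x y => (m.form.toDual m.nondeg).symm ((1 / 2 : ℝ) • m.koszul x y))
    (fun x x' y => by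
      rw [← map_add, ← smul_add]; congr 2; ext z
      simp only [koszul, LinearMap.coe_mk, AddHom.coe_mk, map_add, lie_add, add_lie,
        LinearMap.add_apply]; ring)
    (fun c x y => by
      rw [← map_smul, smul_comm]; congr 2; ext z
      simp only [koszul, LinearMap.coe_mk, AddHom.coe_mk, map_smul, lie_smul, smul_lie,
        LinearMap.smul_apply, smul_eq_mul]; ring)
    (fun x y y' => by
      rw [← map_add, ← smul_add]; congr 2; ext z
      simp only [koszul, LinearMap.coe_mk, AddHom.coe_mk, map_add, lie_add, add_lie,
        LinearMap.add_apply]; ring)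
    (fun c x y => by
      rw [← map_smul, smul_comm]; congr 2; ext z
      simp only [koszul, LinearMap.coe_mk, AddHom.coe_mk, map_smul, lie_smul, smul_lie,
        LinearMap.smul_apply, smul_eq_mul]; ring)

theorem two_mul_form_nabla (m : LeftInvMetric g) (x y z : g) :
    2 * m.form (m.nabla x y) z
      = m.form ⁅x, y⁆ z - m.form ⁅y, z⁆ x + m.form ⁅z, x⁆ y := by
  have h : m.form (m.nabla x y) z = (1 / 2 : ℝ) * m.koszul x y z := by
    simp only [nabla, LinearMap.mk₂_apply, LinearMap.BilinForm.apply_toDual_symm_apply,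
      LinearMap.smul_apply, smul_eq_mul]
  rw [h]
  simp only [koszul, LinearMap.coe_mk, AddHom.coe_mk]
  ring

/-- The curvature operator `R(x,y) = ∇ₓ ∇_y - ∇_y ∇ₓ - ∇_[x,y]`. -/
noncomputable def curv (m : LeftInvMetric g) (x y : g) : g →ₗ[ℝ] g :=
  m.nabla x ∘ₗ m.nabla y - m.nabla y ∘ₗ m.nabla x - m.nabla ⁅x, y⁆

/-- The Ricci tensor `ρ(x,y) = Tr (z ↦ R(z,x) y)`. -/
noncomputable def ricci (m : LeftInvMetric g) (x y : g) : ℝ :=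
  LinearMap.trace ℝ g
    { toFun := fun z => m.curv z x y
      map_add' := fun z w => by
        simp only [curv, map_add, add_lie, LinearMap.sub_apply, LinearMap.comp_apply,
          LinearMap.add_apply]; abel
      map_smul' := fun c z => by
        simp only [curv, map_smul, smul_lie, LinearMap.sub_apply, LinearMap.comp_apply,
          LinearMap.smul_apply, smul_sub, RingHom.id_apply] }

/-- The covariant derivative `(∇_w R)(x,y) z`. -/
noncomputable def nablaCurv (m : LeftInvMetric g) (w x y z : g) : g :=
  m.nabla w (m.curv x y z) - m.curv (m.nabla w x) y z - m.curv x (m.nabla w y) z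
    - m.curv x y (m.nabla w z)

/-- The covariant derivative `(∇_w ρ)(x,y)`; the function `ρ(x,y)` is constant on left invariant
fields, so its derivative along `w` does not contribute. -/
noncomputable def nablaRicci (m : LeftInvMetric g) (w x y : g) : ℝ :=
  -m.ricci (m.nabla w x) y - m.ricci x (m.nabla w y)

/-- `R = 0`. -/
def IsFlat (m : LeftInvMetric g) : Prop := ∀ x y z : g, m.curv x y z = 0

/-- `∇R = 0`. -/
def IsLocallySymmetric (m : LeftInvMetric g) : Prop := ∀ w x y z : g, m.nablaCurv w x y z = 0

/-- `ρ = 0`. -/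
def IsRicciFlat (m : LeftInvMetric g) : Prop := ∀ x y : g, m.ricci x y = 0

/-- `∇ρ = 0`. -/
def IsRicciParallel (m : LeftInvMetric g) : Prop := ∀ w x y : g, m.nablaRicci w x y = 0

/-- The Ricci tensor is a constant multiple of the metric. -/
def IsEinstein (m : LeftInvMetric g) : Prop := ∃ c : ℝ, ∀ x y : g, m.ricci x y = c * m.form x y

/-- The restriction of the metric to the derived algebra `[g, g]`. -/
def derivedForm (m : LeftInvMetric g) :
    LinearMap.BilinForm ℝ (LieAlgebra.derivedSeries ℝ g 1).toSubmodule :=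
  m.form.restrict (LieAlgebra.derivedSeries ℝ g 1).toSubmodule

/-- The rank of the restriction of the metric to the derived algebra. -/
noncomputable def derivedRank (m : LeftInvMetric g) : ℕ :=
  Module.finrank ℝ (LinearMap.range m.derivedForm)

end LeftInvMetric

end MetricLieAlgebra

/-! ### The cotangent algebra of the Heisenberg algebra -/

/-- The Heisenberg Lie algebra: the vectors `c₁ x₁ + c₂ x₂ + c₃ x₃`, with the bracket whose only
nonzero commutator of basis vectors is `[x₁, x₂] = x₃`. -/
@[ext]
structure Heis3 : Type where
  c₁ : ℝ
  c₂ : ℝ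
  c₃ : ℝ

namespace Heis3

/-- Coordinates. -/
def equivFun : Heis3 ≃ (Fin 3 → ℝ) where
  toFun u := ![u.c₁, u.c₂, u.c₃]
  invFun v := ⟨v 0, v 1, v 2⟩
  left_inv _ := rfl
  right_inv v := by funext i; fin_cases i <;> rfl

theorem equivFun_apply (u : Heis3) : equivFun u = ![u.c₁, u.c₂, u.c₃] := rfl

noncomputable instance : AddCommGroup Heis3 := equivFun.addCommGroup
noncomputable instance : Module ℝ Heis3 := equivFun.module ℝ

@[simp] theorem add_c₁ (u v : Heis3) : (u + v).c₁ = u.c₁ + v.c₁ := rfl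
@[simp] theorem add_c₂ (u v : Heis3) : (u + v).c₂ = u.c₂ + v.c₂ := rfl
@[simp] theorem add_c₃ (u v : Heis3) : (u + v).c₃ = u.c₃ + v.c₃ := rfl
@[simp] theorem zero_c₁ : (0 : Heis3).c₁ = 0 := rfl
@[simp] theorem zero_c₂ : (0 : Heis3).c₂ = 0 := rfl
@[simp] theorem zero_c₃ : (0 : Heis3).c₃ = 0 := rfl
@[simp] theorem smul_c₁ (r : ℝ) (u : Heis3) : (r • u).c₁ = r * u.c₁ := rfl
@[simp] theorem smul_c₂ (r : ℝ) (u : Heis3) : (r • u).c₂ = r * u.c₂ := rfl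
@[simp] theorem smul_c₃ (r : ℝ) (u : Heis3) : (r • u).c₃ = r * u.c₃ := rfl

/-- The basis `(x₁, x₂, x₃)`. -/
noncomputable def basis : Module.Basis (Fin 3) ℝ Heis3 :=
  Module.Basis.ofEquivFun (equivFun.linearEquiv ℝ)

instance : FiniteDimensional ℝ Heis3 := Module.Basis.finiteDimensional_of_finite basis

noncomputable instance : Bracket Heis3 Heis3 where
  bracket u v := ⟨0, 0, u.c₁ * v.c₂ - u.c₂ * v.c₁⟩

@[simp] theorem lie_c₁ (u v : Heis3) : ⁅u, v⁆.c₁ = 0 := rfl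
@[simp] theorem lie_c₂ (u v : Heis3) : ⁅u, v⁆.c₂ = 0 := rfl
@[simp] theorem lie_c₃ (u v : Heis3) : ⁅u, v⁆.c₃ = u.c₁ * v.c₂ - u.c₂ * v.c₁ := rfl

noncomputable instance : LieRing Heis3 where
  add_lie u v w := by ext <;> simp; ring
  lie_add u v w := by ext <;> simp; ring
  lie_self u := by ext <;> simp; ring
  leibniz_lie u v w := by ext <;> simp

noncomputable instance : LieAlgebra ℝ Heis3 where
  lie_smul c u v := by ext <;> simp; ring

theorem basis_zero : basis 0 = ⟨1, 0, 0⟩ := by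
  rw [basis, Module.Basis.coe_ofEquivFun]
  change equivFun.symm (Pi.single _ 1) = _
  rw [Equiv.symm_apply_eq, equivFun_apply]
  funext i; fin_cases i <;> simp

theorem basis_one : basis 1 = ⟨0, 1, 0⟩ := by
  rw [basis, Module.Basis.coe_ofEquivFun]
  change equivFun.symm (Pi.single _ 1) = _
  rw [Equiv.symm_apply_eq, equivFun_apply]
  funext i; fin_cases i <;> simp

theorem basis_two : basis 2 = ⟨0, 0, 1⟩ := by
  rw [basis, Module.Basis.coe_ofEquivFun]
  change equivFun.symm (Pi.single _ 1) = _
  rw [Equiv.symm_apply_eq, equivFun_apply]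
  funext i; fin_cases i <;> simp

end Heis3

/-- The cotangent algebra `T*g = g ⋉ g*` of a Lie algebra `g`: pairs `(x, φ)` with `x ∈ g` and
`φ ∈ g*`. -/
@[ext]
structure CotangentAlgebra (g : Type*) [LieRing g] [LieAlgebra ℝ g] where
  base : g
  covec : Module.Dual ℝ g

namespace CotangentAlgebra

variable {g : Type*} [LieRing g] [LieAlgebra ℝ g]

/-- Pairs as elements of the product space. -/
def equivProd : CotangentAlgebra g ≃ g × Module.Dual ℝ g where
  toFun a := (a.base, a.covec)
  invFun p := ⟨p.1, p.2⟩
  left_inv _ := rfl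
  right_inv _ := rfl

noncomputable instance : AddCommGroup (CotangentAlgebra g) := equivProd.addCommGroup
noncomputable instance : Module ℝ (CotangentAlgebra g) := equivProd.module ℝ
instance [FiniteDimensional ℝ g] : FiniteDimensional ℝ (CotangentAlgebra g) :=
  LinearEquiv.finiteDimensional (equivProd.linearEquiv ℝ).symm

/-- `[(x,φ), (y,ψ)] = ([x,y], ad*(x)(ψ) - ad*(y)(φ))`, where `ad*` is the coadjoint representation
`(ad*(x)(φ))(y) = - φ([x,y])`, written `⁅x, φ⁆`. -/
noncomputable instance : Bracket (CotangentAlgebra g) (CotangentAlgebra g) where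
  bracket a b := ⟨⁅a.base, b.base⁆, ⁅a.base, b.covec⁆ - ⁅b.base, a.covec⁆⟩

theorem coadjoint_apply (x y : g) (φ : Module.Dual ℝ g) : ⁅x, φ⁆ y = -φ ⁅x, y⁆ := rfl

@[simp] theorem add_base (a b : CotangentAlgebra g) : (a + b).base = a.base + b.base := rfl
@[simp] theorem add_covec (a b : CotangentAlgebra g) : (a + b).covec = a.covec + b.covec := rfl
@[simp] theorem zero_base : (0 : CotangentAlgebra g).base = 0 := rfl
@[simp] theorem zero_covec : (0 : CotangentAlgebra g).covec = 0 := rfl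
@[simp] theorem neg_base (a : CotangentAlgebra g) : (-a).base = -a.base := rfl
@[simp] theorem neg_covec (a : CotangentAlgebra g) : (-a).covec = -a.covec := rfl
@[simp] theorem smul_base (c : ℝ) (a : CotangentAlgebra g) : (c • a).base = c • a.base := rfl
@[simp] theorem smul_covec (c : ℝ) (a : CotangentAlgebra g) : (c • a).covec = c • a.covec := rfl
@[simp] theorem lie_base (a b : CotangentAlgebra g) : ⁅a, b⁆.base = ⁅a.base, b.base⁆ := rfl
@[simp] theorem lie_covec (a b : CotangentAlgebra g) :
    ⁅a, b⁆.covec = ⁅a.base, b.covec⁆ - ⁅b.base, a.covec⁆ := rfl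

noncomputable instance : LieRing (CotangentAlgebra g) where
  add_lie a b c := by
    refine CotangentAlgebra.ext ?_ ?_
    · simp
    · simp only [lie_covec, add_base, add_covec, add_lie, lie_add]; abel
  lie_add a b c := by
    refine CotangentAlgebra.ext ?_ ?_
    · simp
    · simp only [lie_covec, add_base, add_covec, add_lie, lie_add]; abel
  lie_self a := by
    refine CotangentAlgebra.ext ?_ ?_ <;> simp
  leibniz_lie a b c := by
    refine CotangentAlgebra.ext ?_ ?_
    · simp
    · simp only [lie_covec, lie_base, lie_sub, add_covec, lie_lie]; abel

noncomputable instance : LieAlgebra ℝ (CotangentAlgebra g) where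
  lie_smul c a b := by
    refine CotangentAlgebra.ext ?_ ?_
    · simp
    · refine LinearMap.ext fun y => ?_
      simp only [lie_covec, smul_base, smul_covec, LinearMap.sub_apply, LinearMap.smul_apply,
        coadjoint_apply, smul_lie, smul_eq_mul]
      ring

end CotangentAlgebra

/-- The Lie algebra `T*h₃`. -/
abbrev TStarHeis3 : Type := CotangentAlgebra Heis3

/-- A basis `e = (e₁, …, e₆)` of `T*h₃` whose nonzero commutators are
`[e₁, e₂] = e₆`, `[e₁, e₃] = -e₅`, `[e₂, e₃] = e₄`.  Here `e (inl 0), e (inl 1), e (inl 2)` are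
`e₁, e₂, e₃` and `e (inr 0), e (inr 1), e (inr 2)` are `e₄, e₅, e₆`. -/
structure IsAdaptedBasis (e : Module.Basis (Fin 3 ⊕ Fin 3) ℝ TStarHeis3) : Prop where
  lie_one_two : ⁅e (.inl 0), e (.inl 1)⁆ = e (.inr 2)
  lie_one_three : ⁅e (.inl 0), e (.inl 2)⁆ = -e (.inr 1)
  lie_two_three : ⁅e (.inl 1), e (.inl 2)⁆ = e (.inr 0)
  lie_inr : ∀ (i : Fin 3) (a : Fin 3 ⊕ Fin 3), ⁅e a, e (.inr i)⁆ = 0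

/-- With `x¹, x², x³` the dual basis, `(x₁, x₂, x³, x¹, x², x₃)` is such a basis of `T*h₃`. -/
theorem IsAdaptedBasis.nonempty : ∃ e, IsAdaptedBasis e := by
  let x := Heis3.basis
  have hd : ∀ (i : Fin 3) (u : Heis3), x.dualBasis i u = Heis3.equivFun u i := fun i u => by
    rw [Module.Basis.dualBasis_apply]
    rfl
  let p : Module.Basis (Fin 3 ⊕ Fin 3) ℝ TStarHeis3 :=
    (x.prod x.dualBasis).map (CotangentAlgebra.equivProd.linearEquiv ℝ).symm
  have hl : ∀ i, p (.inl i) = ⟨x i, 0⟩ := fun i => by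
    refine CotangentAlgebra.ext ?_ ?_
    · exact Module.Basis.prod_apply_inl_fst x x.dualBasis i
    · exact Module.Basis.prod_apply_inl_snd x x.dualBasis i
  have hr : ∀ i, p (.inr i) = ⟨0, x.dualBasis i⟩ := fun i => by
    refine CotangentAlgebra.ext ?_ ?_
    · exact Module.Basis.prod_apply_inr_fst x x.dualBasis i
    · exact Module.Basis.prod_apply_inr_snd x x.dualBasis i
  let σ : Equiv.Perm (Fin 3 ⊕ Fin 3) := Equiv.swap (.inl 2) (.inr 2)
  have hp : ∀ a, (p.reindex σ) a = p (σ.symm a) := fun a => Module.Basis.reindex_apply p σ a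
  have e1 : (p.reindex σ) (.inl 0) = ⟨⟨1, 0, 0⟩, 0⟩ := by
    rw [hp, show σ.symm (.inl 0) = .inl 0 by decide, hl, ← Heis3.basis_zero]
  have e2 : (p.reindex σ) (.inl 1) = ⟨⟨0, 1, 0⟩, 0⟩ := by
    rw [hp, show σ.symm (.inl 1) = .inl 1 by decide, hl, ← Heis3.basis_one]
  have e3 : (p.reindex σ) (.inl 2) = ⟨0, x.dualBasis 2⟩ := by
    rw [hp, show σ.symm (.inl 2) = .inr 2 by decide, hr]
  have e4 : (p.reindex σ) (.inr 0) = ⟨0, x.dualBasis 0⟩ := by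
    rw [hp, show σ.symm (.inr 0) = .inr 0 by decide, hr]
  have e5 : (p.reindex σ) (.inr 1) = ⟨0, x.dualBasis 1⟩ := by
    rw [hp, show σ.symm (.inr 1) = .inr 1 by decide, hr]
  have e6 : (p.reindex σ) (.inr 2) = ⟨⟨0, 0, 1⟩, 0⟩ := by
    rw [hp, show σ.symm (.inr 2) = .inl 2 by decide, hl, ← Heis3.basis_two]
  refine ⟨p.reindex σ, ?_, ?_, ?_, ?_⟩
  · rw [e1, e2, e6]
    refine CotangentAlgebra.ext ?_ ?_
    · ext <;> simp
    · simp
  · rw [e1, e3, e5]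
    refine CotangentAlgebra.ext ?_ (LinearMap.ext fun y => ?_)
    · simp
    · simp only [CotangentAlgebra.lie_covec, CotangentAlgebra.neg_covec, LinearMap.sub_apply,
        LinearMap.neg_apply, CotangentAlgebra.coadjoint_apply, hd]
      simp [Heis3.equivFun_apply]
  · rw [e2, e3, e4]
    refine CotangentAlgebra.ext ?_ (LinearMap.ext fun y => ?_)
    · simp
    · simp only [CotangentAlgebra.lie_covec, LinearMap.sub_apply,
        CotangentAlgebra.coadjoint_apply, hd]
      simp [Heis3.equivFun_apply]
  · have hc : ∀ i : Fin 3, i ≠ 2 → ∀ a : TStarHeis3,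
        ⁅a, (⟨0, x.dualBasis i⟩ : TStarHeis3)⁆ = 0 := fun i hi a => by
      refine CotangentAlgebra.ext ?_ (LinearMap.ext fun y => ?_)
      · simp
      · simp only [CotangentAlgebra.lie_covec, LinearMap.sub_apply,
          CotangentAlgebra.coadjoint_apply, hd]
        fin_cases i
        · simp [Heis3.equivFun_apply]
        · simp [Heis3.equivFun_apply]
        · exact absurd rfl hi
    have hc2 : ∀ a : TStarHeis3, ⁅a, (⟨⟨0, 0, 1⟩, 0⟩ : TStarHeis3)⁆ = 0 := fun a => by
      refine CotangentAlgebra.ext ?_ (LinearMap.ext fun y => ?_)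
      · ext <;> simp
      · simp only [CotangentAlgebra.lie_covec, LinearMap.sub_apply,
          CotangentAlgebra.coadjoint_apply]
        have h : ⁅(⟨0, 0, 1⟩ : Heis3), y⁆ = 0 := by ext <;> simp
        rw [h]
        simp
    intro i a
    fin_cases i
    · exact e4 ▸ hc 0 (by decide) _
    · exact e5 ▸ hc 1 (by decide) _
    · exact e6 ▸ hc2 _

/-- The matrix of the metric in the basis `e` is
`S_pq = (S, M, E) = [[S, M], [Mᵀ, E]]`. -/
def LeftInvMetric.HasMatrix (m : LeftInvMetric TStarHeis3)
    (e : Module.Basis (Fin 3 ⊕ Fin 3) ℝ TStarHeis3) (S M E : Matrix (Fin 3) (Fin 3) ℝ) : Prop :=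
  LinearMap.BilinForm.toMatrix e m.form = Matrix.fromBlocks S M M.transpose E

/-- Every nondegenerate symmetric block matrix is the matrix of a metric. -/
theorem LeftInvMetric.exists_hasMatrix (e : Module.Basis (Fin 3 ⊕ Fin 3) ℝ TStarHeis3)
    (S M E : Matrix (Fin 3) (Fin 3) ℝ) (hS : S.IsSymm) (hE : E.IsSymm)
    (hdet : (Matrix.fromBlocks S M M.transpose E).det ≠ 0) :
    ∃ m : LeftInvMetric TStarHeis3, m.HasMatrix e S M E := by
  have hsymm : (Matrix.fromBlocks S M M.transpose E).IsSymm :=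
    Matrix.IsSymm.fromBlocks hS rfl hE
  refine ⟨⟨Matrix.toBilin e (Matrix.fromBlocks S M M.transpose E), ?_, ?_⟩, ?_⟩
  · rw [LinearMap.BilinForm.isSymm_iff_basis e]
    intro i j
    rw [← LinearMap.BilinForm.toMatrix_apply e, ← LinearMap.BilinForm.toMatrix_apply e,
      LinearMap.BilinForm.toMatrix_toBilin]
    exact hsymm.apply j i
  · rw [LinearMap.BilinForm.nondegenerate_iff_det_ne_zero e, LinearMap.BilinForm.toMatrix_toBilin]
    exact hdet
  · exact LinearMap.BilinForm.toMatrix_toBilin e _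

/-- `E₂₀ = diag (0, 1, 1)`. -/
def E20 : Matrix (Fin 3) (Fin 3) ℝ := !![0, 0, 0; 0, 1, 0; 0, 0, 1]

/-- `E₁₁ = diag (0, 1, -1)`. -/
def E11 : Matrix (Fin 3) (Fin 3) ℝ := !![0, 0, 0; 0, 1, 0; 0, 0, -1]

/-- `E₁₀ = diag (0, 0, 1)`. -/
def E10 : Matrix (Fin 3) (Fin 3) ℝ := !![0, 0, 0; 0, 0, 0; 0, 0, 1]

/-- The block `M` with `m₁₁ = 1` and all other entries zero. -/
def M11 : Matrix (Fin 3) (Fin 3) ℝ := !![1, 0, 0; 0, 0, 0; 0, 0, 0]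

/-! ### Curvature in terms of the metric -/

namespace LeftInvMetric

section General

variable {g : Type*} [LieRing g] [LieAlgebra ℝ g] [FiniteDimensional ℝ g]

/-! On a two-step nilpotent metric Lie algebra Koszul's formula reads `2∇_u = ad_u - ad_u* - J_u`,
where `⟨J_u v, w⟩ = ⟨[v, w], u⟩`. Most products of these operators vanish or are traceless, which
leaves `ρ(x, y) = -½ tr(ad_y* ad_x) - ¼ tr(J_x J_y)` (`ricci_eq_trace`).

On `T*h₃` the bracket is the cross product of the `e₁, e₂, e₃` coordinates, with values in the span
of `e₄, e₅, e₆`. Both traces then become adjugates of `3 × 3` matrices: with `A` the upper left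
block of the inverse Gram matrix, `ρ` is built from the polarized adjugate of `A` and `E` and from
`adj A` (`HasMatrix.exists_ricci_eq`).

If `ρ = c⟨·,·⟩`, the block equations give `adj(A) E = 2c` and, after multiplication by `A`, `-½
adj(A, E) A = c`. Their traces are proportional by Euler's identity for the cubic `det`, so `-6c =
3c` and `c = 0`. If `E` is invertible, Ricci-flatness forces `adj A = 0`, although `A` is inverse to
a Schur complement.

When `E` has a zero row, the corresponding central vector `z` is orthogonal to the derived algebra,
and `⟨·, z⟩` is a parallel one-form. In the rank 2 families, and in the last rank 1 family, `ρ` is a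
multiple of the square of such a form, hence parallel. In the other rank 1 families there are two
such forms; `R` is a constant times the square of their wedge product, hence parallel, and flatness
is the vanishing of that constant. When `E = 0`, all covariant derivatives lie in the derived
algebra, and every term of `R` vanishes. -/

omit [FiniteDimensional ℝ g] in
theorem form_comm (m : LeftInvMetric g) (x y : g) : m.form x y = m.form y x := m.symm.eq x y

theorem eq_of_form_left (m : LeftInvMetric g) {u v : g} (h : ∀ w, m.form u w = m.form v w) :
    u = v :=
  (m.form.toDual m.nondeg).injective (LinearMap.ext fun w => by
    simpa only [LinearMap.BilinForm.toDual_def] using h w)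

theorem eq_zero_of_form_left (m : LeftInvMetric g) {u : g} (h : ∀ w, m.form u w = 0) : u = 0 :=
  m.eq_of_form_left fun w => by rw [h, map_zero, LinearMap.zero_apply]

/-- The Levi-Civita connection is metric. -/
theorem form_nabla_left (m : LeftInvMetric g) (x y z : g) :
    m.form (m.nabla x y) z = -m.form y (m.nabla x z) := by
  have h₁ := m.two_mul_form_nabla x y z
  have h₂ := m.two_mul_form_nabla x z y
  rw [← lie_skew x z, ← lie_skew y x, ← lie_skew z y] at h₂
  simp only [map_neg, LinearMap.neg_apply] at h₂
  rw [m.form_comm y]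
  linarith

/-- The Levi-Civita connection is torsion-free. -/
theorem nabla_sub_nabla (m : LeftInvMetric g) (x y : g) : m.nabla x y - m.nabla y x = ⁅x, y⁆ := by
  refine m.eq_of_form_left fun w => ?_
  have h₁ := m.two_mul_form_nabla x y w
  have h₂ := m.two_mul_form_nabla y x w
  rw [← lie_skew y x, ← lie_skew x w, ← lie_skew w y] at h₂
  simp only [map_neg, map_sub, LinearMap.neg_apply, LinearMap.sub_apply] at h₁ h₂ ⊢
  linarith

theorem curv_apply (m : LeftInvMetric g) (x y z : g) :
    m.curv x y z = m.nabla x (m.nabla y z) - m.nabla y (m.nabla x z) - m.nabla ⁅x, y⁆ z := rfl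

/-- The curvature tensor in terms of first derivatives. -/
theorem form_curv (m : LeftInvMetric g) (x y z w : g) :
    m.form (m.curv x y z) w = m.form (m.nabla x z) (m.nabla y w)
      - m.form (m.nabla y z) (m.nabla x w) - m.form (m.nabla ⁅x, y⁆ z) w := by
  rw [curv_apply, map_sub, map_sub, LinearMap.sub_apply, LinearMap.sub_apply, form_nabla_left,
    form_nabla_left m y (m.nabla x z)]
  ring

/-- The covariant derivative of a vector field that is central and orthogonal to the derived algebra
vanishes; dually, all covariant derivatives are orthogonal to it. -/
theorem form_nabla_eq_zero (m : LeftInvMetric g) {z : g} (hc : ∀ x : g, ⁅x, z⁆ = 0)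
    (hd : ∀ x y : g, m.form ⁅x, y⁆ z = 0) (x y : g) : m.form (m.nabla x y) z = 0 := by
  have h := m.two_mul_form_nabla x y z
  rw [hd, hc, ← lie_skew, hc] at h
  simp only [neg_zero, map_zero, LinearMap.zero_apply, sub_zero, add_zero] at h
  linarith

theorem IsFlat.isRicciFlat {m : LeftInvMetric g} (h : m.IsFlat) : m.IsRicciFlat := by
  intro x y
  rw [ricci, ← map_zero (LinearMap.trace ℝ g)]
  congr 1
  exact LinearMap.ext fun z => h z x y

/-! ### Coordinates, traces and adjoints with respect to the metric. -/

omit [FiniteDimensional ℝ g] in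
theorem repr_eq_sum (m : LeftInvMetric g) {ι : Type*} [Fintype ι] [DecidableEq ι]
    (e : Module.Basis ι ℝ g) {H : Matrix ι ι ℝ}
    (hH : H * LinearMap.BilinForm.toMatrix e m.form = 1) (u : g) (a : ι) :
    e.repr u a = ∑ b, H a b * m.form (e b) u := by
  have h : e.coord a = ∑ b, H a b • m.form (e b) := by
    refine e.ext fun c => ?_
    have := congrFun (congrFun hH a) c
    simp only [Matrix.mul_apply, LinearMap.BilinForm.toMatrix_apply] at this
    simp [LinearMap.sum_apply, this, Matrix.one_apply, Finsupp.single_apply, eq_comm]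
  simpa [LinearMap.sum_apply] using LinearMap.congr_fun h u

omit [FiniteDimensional ℝ g] in
theorem trace_eq_sum (m : LeftInvMetric g) {ι : Type*} [Fintype ι] [DecidableEq ι]
    (e : Module.Basis ι ℝ g) {H : Matrix ι ι ℝ}
    (hH : H * LinearMap.BilinForm.toMatrix e m.form = 1) (T : g →ₗ[ℝ] g) :
    LinearMap.trace ℝ g T = ∑ a, ∑ b, H a b * m.form (e b) (T (e a)) := by
  rw [LinearMap.trace_eq_matrix_trace ℝ e, Matrix.trace]
  simp only [Matrix.diag_apply, LinearMap.toMatrix_apply, m.repr_eq_sum e hH]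

/-- The isomorphism `toDual` conjugates `S` into the transpose of `T`, and the trace is unchanged by
conjugation and by transposition. -/
theorem trace_eq_of_isAdjointPair (m : LeftInvMetric g) {S T : g →ₗ[ℝ] g}
    (h : ∀ u v, m.form (S u) v = m.form u (T v)) :
    LinearMap.trace ℝ g S = LinearMap.trace ℝ g T := by
  rw [← LinearMap.trace_transpose' T, ← LinearMap.trace_conj' S (m.form.toDual m.nondeg)]
  congr 1
  refine LinearMap.ext fun φ => LinearMap.ext fun v => ?_
  obtain ⟨u, rfl⟩ := (m.form.toDual m.nondeg).surjective φ
  simp only [LinearEquiv.conj_apply_apply, LinearEquiv.symm_apply_apply,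
    LinearMap.BilinForm.toDual_def, Module.Dual.transpose_apply, LinearMap.comp_apply, h]

/-- The adjoint of `ad y` with respect to the metric. -/
noncomputable def adStar (m : LeftInvMetric g) (y : g) : g →ₗ[ℝ] g :=
  m.form.leftAdjointOfNondegenerate m.nondeg (LieAlgebra.ad ℝ g y)

theorem form_adStar_left (m : LeftInvMetric g) (y u v : g) :
    m.form (m.adStar y u) v = m.form u ⁅y, v⁆ :=
  m.form.isAdjointPairLeftAdjointOfNondegenerate m.nondeg (LieAlgebra.ad ℝ g y) u v

theorem form_adStar_right (m : LeftInvMetric g) (y u v : g) :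
    m.form u (m.adStar y v) = m.form ⁅y, u⁆ v := by
  rw [form_comm, form_adStar_left, form_comm]

/-- The skew-symmetric map `J_y` with `⟨J_y u, v⟩ = ⟨[u, v], y⟩`. -/
noncomputable def skewMap (m : LeftInvMetric g) (y : g) : g →ₗ[ℝ] g :=
  LieAlgebra.ad ℝ g y - m.adStar y - (2 : ℝ) • m.nabla y

theorem form_skewMap_left (m : LeftInvMetric g) (y u v : g) :
    m.form (m.skewMap y u) v = m.form ⁅u, v⁆ y := by
  have h := m.two_mul_form_nabla y u v
  rw [← lie_skew v y] at h
  simp only [skewMap, LinearMap.sub_apply, LinearMap.smul_apply, LieAlgebra.ad_apply, map_sub,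
    map_smul, form_adStar_left, smul_eq_mul, map_neg, LinearMap.neg_apply] at h ⊢
  rw [m.form_comm u]
  linarith

theorem form_skewMap_right (m : LeftInvMetric g) (y u v : g) :
    m.form u (m.skewMap y v) = m.form ⁅v, u⁆ y := by
  rw [form_comm, form_skewMap_left]

open LinearMap (trace) in
/-- The Ricci tensor of a two-step nilpotent metric Lie algebra. -/
theorem ricci_eq_trace (m : LeftInvMetric g) (h2 : ∀ x y z : g, ⁅⁅x, y⁆, z⁆ = 0) (x y : g) :
    m.ricci x y = -(1 / 2) * trace ℝ g (m.adStar y ∘ₗ LieAlgebra.ad ℝ g x)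
      - (1 / 4) * trace ℝ g (m.skewMap x ∘ₗ m.skewMap y) := by
  have h2' : ∀ x y z : g, ⁅x, ⁅y, z⁆⁆ = 0 := fun x y z => by rw [← lie_skew, h2, neg_zero]
  have had (u v : g) : LieAlgebra.ad ℝ g u ∘ₗ LieAlgebra.ad ℝ g v = 0 :=
    LinearMap.ext fun w => by simp [h2']
  have htr (u : g) : trace ℝ g (LieAlgebra.ad ℝ g u) = 0 :=
    (LinearMap.isNilpotent_trace_of_isNilpotent ⟨2, by rw [pow_two]; exact had u u⟩).eq_zero
  have htrS (u : g) : trace ℝ g (m.adStar u) = 0 := by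
    rw [m.trace_eq_of_isAdjointPair (T := LieAlgebra.ad ℝ g u) (m.form_adStar_left u), htr]
  -- The adjoint of `J_u` is `-J_u`, so its trace equals its own negative.
  have htrJ (u : g) : trace ℝ g (m.skewMap u) = 0 := by
    have := m.trace_eq_of_isAdjointPair (S := m.skewMap u) (T := -m.skewMap u) fun v w => by
      rw [form_skewMap_left, LinearMap.neg_apply, map_neg, form_skewMap_right, ← lie_skew, map_neg,
        LinearMap.neg_apply]
    rw [map_neg] at this
    linarith
  have hJad (u v : g) : m.skewMap u ∘ₗ LieAlgebra.ad ℝ g v = 0 :=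
    LinearMap.ext fun w => m.eq_zero_of_form_left fun t => by
      rw [LinearMap.comp_apply, LieAlgebra.ad_apply, form_skewMap_left, h2, map_zero,
        LinearMap.zero_apply]
  have hSJ (u v : g) : m.adStar v ∘ₗ m.skewMap u = 0 :=
    LinearMap.ext fun w => m.eq_zero_of_form_left fun t => by
      rw [LinearMap.comp_apply, form_adStar_left, form_skewMap_left, h2', map_zero,
        LinearMap.zero_apply]
  have hSS (u v : g) : m.adStar v ∘ₗ m.adStar u = 0 :=
    LinearMap.ext fun w => m.eq_zero_of_form_left fun t => by
      rw [LinearMap.comp_apply, form_adStar_left, form_adStar_left, h2', map_zero]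
  have hadS : trace ℝ g (LieAlgebra.ad ℝ g x ∘ₗ m.adStar y)
      = trace ℝ g (m.adStar x ∘ₗ LieAlgebra.ad ℝ g y) := by
    rw [LinearMap.trace_comp_comm']
    refine m.trace_eq_of_isAdjointPair fun u v => ?_
    rw [LinearMap.comp_apply, LinearMap.comp_apply, form_adStar_left, form_adStar_right]
    rfl
  have hnabla (u : g) :
      m.nabla u = (1 / 2 : ℝ) • (LieAlgebra.ad ℝ g u - m.adStar u - m.skewMap u) := by
    rw [skewMap, sub_sub_cancel, smul_smul]; norm_num
  have hflip (u : g) :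
      m.nabla.flip u = -(1 / 2 : ℝ) • (LieAlgebra.ad ℝ g u + m.adStar u + m.skewMap u) := by
    have : m.nabla.flip u = m.nabla u - LieAlgebra.ad ℝ g u := by
      refine LinearMap.ext fun v => ?_
      rw [LinearMap.flip_apply, LinearMap.sub_apply, LieAlgebra.ad_apply, ← m.nabla_sub_nabla u v]
      abel
    rw [this, hnabla]
    module
  -- Reading `z ↦ ∇_z v` as `m.nabla.flip v` turns the integrand into a sum of compositions.
  have hric : m.ricci x y = trace ℝ g (m.nabla.flip (m.nabla x y) - m.nabla x ∘ₗ m.nabla.flip y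
      + m.nabla.flip y ∘ₗ LieAlgebra.ad ℝ g x) := by
    unfold ricci
    congr 1
    refine LinearMap.ext fun z => ?_
    simp only [LinearMap.coe_mk, AddHom.coe_mk, curv_apply, LinearMap.add_apply,
      LinearMap.sub_apply, LinearMap.comp_apply, LinearMap.flip_apply, LieAlgebra.ad_apply]
    rw [← lie_skew z x, map_neg, LinearMap.neg_apply, sub_neg_eq_add]
  rw [hric, hflip, hflip, hnabla]
  have hadJ : trace ℝ g (LieAlgebra.ad ℝ g x ∘ₗ m.skewMap y) = 0 := by
    rw [LinearMap.trace_comp_comm', hJad, map_zero]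
  have hJS : trace ℝ g (m.skewMap x ∘ₗ m.adStar y) = 0 := by
    rw [LinearMap.trace_comp_comm', hSJ, map_zero]
  -- By `hadS` the two mixed terms of `∇_x ∘ ∇.flip y` cancel; only its `J_x J_y` term and the
  -- `ad_y* ad_x` term of the last summand survive.
  simp only [LinearMap.comp_add, LinearMap.add_comp, LinearMap.sub_comp, LinearMap.comp_smul,
    LinearMap.smul_comp, map_add, map_sub, map_smul, htr, htrS, htrJ, had, hJad, hSJ, hSS, hadS,
    hadJ, hJS, map_zero, smul_eq_mul]
  ring

/-- The Ricci tensor of a two-step nilpotent metric Lie algebra in a basis; `H` is the inverse of the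
matrix of the metric. -/
theorem ricci_eq_sum (m : LeftInvMetric g) (h2 : ∀ x y z : g, ⁅⁅x, y⁆, z⁆ = 0) {ι : Type*}
    [Fintype ι] [DecidableEq ι] (e : Module.Basis ι ℝ g) {H : Matrix ι ι ℝ}
    (hH : H * LinearMap.BilinForm.toMatrix e m.form = 1) (x y : g) :
    m.ricci x y = -(1 / 2) * ∑ a, ∑ b, H a b * m.form ⁅y, e b⁆ ⁅x, e a⁆
      - (1 / 4) * ∑ a, ∑ b, H a b *
        ∑ c, (∑ d, H c d * m.form ⁅e a, e d⁆ y) * m.form ⁅e c, e b⁆ x := by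
  have hJ : ∀ a b, m.form (e b) (m.skewMap x (m.skewMap y (e a)))
      = ∑ c, (∑ d, H c d * m.form ⁅e a, e d⁆ y) * m.form ⁅e c, e b⁆ x := fun a b => by
    rw [form_skewMap_right]
    conv_lhs => rw [← e.sum_repr (m.skewMap y (e a))]
    simp only [sum_lie, smul_lie, map_sum, map_smul, LinearMap.sum_apply, LinearMap.smul_apply,
      smul_eq_mul, m.repr_eq_sum e hH, form_skewMap_right]
  rw [m.ricci_eq_trace h2, m.trace_eq_sum e hH, m.trace_eq_sum e hH]
  simp only [LinearMap.comp_apply, form_adStar_right, LieAlgebra.ad_apply, hJ]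

end General

end LeftInvMetric

/-! ### The Ricci tensor of `T*h₃` -/

namespace IsAdaptedBasis

variable {e : Module.Basis (Fin 3 ⊕ Fin 3) ℝ TStarHeis3}

theorem inr_lie (he : IsAdaptedBasis e) (i : Fin 3) (a : Fin 3 ⊕ Fin 3) :
    ⁅e (.inr i), e a⁆ = 0 := by
  rw [← lie_skew, he.lie_inr, neg_zero]

theorem lie_two_one (he : IsAdaptedBasis e) : ⁅e (.inl 1), e (.inl 0)⁆ = -e (.inr 2) := by
  rw [← lie_skew, he.lie_one_two]

theorem lie_three_one (he : IsAdaptedBasis e) : ⁅e (.inl 2), e (.inl 0)⁆ = e (.inr 1) := by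
  rw [← lie_skew, he.lie_one_three, neg_neg]

theorem lie_three_two (he : IsAdaptedBasis e) : ⁅e (.inl 2), e (.inl 1)⁆ = -e (.inr 0) := by
  rw [← lie_skew, he.lie_two_three]

/-- The coefficients form a cross product in `ℝ³`; this is why adjugates of `3 × 3` matrices appear
in the Ricci tensor. -/
theorem lie_eq (he : IsAdaptedBasis e) (x y : TStarHeis3) :
    ⁅x, y⁆ =
      (e.repr x (.inl 1) * e.repr y (.inl 2) - e.repr x (.inl 2) * e.repr y (.inl 1)) • e (.inr 0)
      + (e.repr x (.inl 2) * e.repr y (.inl 0) - e.repr x (.inl 0) * e.repr y (.inl 2)) • e (.inr 1)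
      + (e.repr x (.inl 0) * e.repr y (.inl 1) - e.repr x (.inl 1) * e.repr y (.inl 0))
        • e (.inr 2) := by
  conv_lhs => rw [← e.sum_repr x, ← e.sum_repr y]
  simp only [Fintype.sum_sum_type, Fin.sum_univ_three, add_lie, lie_add, smul_lie, lie_smul,
    he.lie_inr, he.inr_lie, lie_self, he.lie_one_two, he.lie_one_three, he.lie_two_three,
    he.lie_two_one, he.lie_three_one, he.lie_three_two]
  module

theorem lie_inr_right (he : IsAdaptedBasis e) (x : TStarHeis3) (i : Fin 3) :
    ⁅x, e (.inr i)⁆ = 0 := by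
  simp [he.lie_eq x]

theorem lie_inr_left (he : IsAdaptedBasis e) (x : TStarHeis3) (i : Fin 3) :
    ⁅e (.inr i), x⁆ = 0 := by
  rw [← lie_skew, he.lie_inr_right, neg_zero]

theorem form_lie (he : IsAdaptedBasis e) (m : LeftInvMetric TStarHeis3) (x y z : TStarHeis3) :
    m.form ⁅x, y⁆ z =
      (e.repr x (.inl 1) * e.repr y (.inl 2) - e.repr x (.inl 2) * e.repr y (.inl 1))
        * m.form z (e (.inr 0))
      + (e.repr x (.inl 2) * e.repr y (.inl 0) - e.repr x (.inl 0) * e.repr y (.inl 2))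
        * m.form z (e (.inr 1))
      + (e.repr x (.inl 0) * e.repr y (.inl 1) - e.repr x (.inl 1) * e.repr y (.inl 0))
        * m.form z (e (.inr 2)) := by
  rw [m.form_comm, he.lie_eq]
  simp only [map_add, map_smul, smul_eq_mul]

theorem repr_lie_inl (he : IsAdaptedBasis e) (x y : TStarHeis3) (i : Fin 3) :
    e.repr ⁅x, y⁆ (.inl i) = 0 := by
  simp [he.lie_eq]

theorem lie_lie (he : IsAdaptedBasis e) (x y z : TStarHeis3) : ⁅⁅x, y⁆, z⁆ = 0 := by
  rw [he.lie_eq x y, ← lie_skew]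
  simp only [lie_add, lie_smul, he.lie_inr_right, smul_zero, add_zero, neg_zero]

end IsAdaptedBasis

/-! ### Polarized adjugates of `3 × 3` matrices. -/

namespace Matrix

/-- The polarization of the adjugate of `3 × 3` matrices. -/
noncomputable def mixedAdjugate (A E : Matrix (Fin 3) (Fin 3) ℝ) : Matrix (Fin 3) (Fin 3) ℝ :=
  (A + E).adjugate - A.adjugate - E.adjugate

/-- The left side is the second derivative of `det` at `A` in the directions `E` and `A`. Since `A ↦
tr(adj(A) E)`, the first derivative in the direction `E`, is homogeneous of degree 2, Euler's
identity gives the factor 2. -/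
theorem trace_mixedAdjugate_mul (A E : Matrix (Fin 3) (Fin 3) ℝ) :
    (mixedAdjugate A E * A).trace = 2 * (A.adjugate * E).trace := by
  simp only [mixedAdjugate, trace_fin_three, adjugate_fin_three, mul_apply, Fin.sum_univ_three,
    sub_apply, add_apply, of_apply, cons_val', cons_val_zero, cons_val_one, cons_val,
    cons_val_fin_one]
  ring

end Matrix

/-! ### Block form of the metric and of its Ricci tensor. -/

namespace LeftInvMetric

variable {m : LeftInvMetric TStarHeis3} {e : Module.Basis (Fin 3 ⊕ Fin 3) ℝ TStarHeis3}
  {S M E : Matrix (Fin 3) (Fin 3) ℝ}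

theorem exists_blocks (m : LeftInvMetric TStarHeis3)
    (e : Module.Basis (Fin 3 ⊕ Fin 3) ℝ TStarHeis3) : ∃ S M E, m.HasMatrix e S M E := by
  refine ⟨.of fun i j => m.form (e (.inl i)) (e (.inl j)),
    .of fun i j => m.form (e (.inl i)) (e (.inr j)),
    .of fun i j => m.form (e (.inr i)) (e (.inr j)), ?_⟩
  ext (i | i) (j | j) <;>
    simp [LinearMap.BilinForm.toMatrix_apply, m.form_comm (e (.inr _)) (e (.inl _))]

theorem HasMatrix.form_inl_inl (h : m.HasMatrix e S M E) (i j : Fin 3) :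
    m.form (e (.inl i)) (e (.inl j)) = S i j := by
  rw [← LinearMap.BilinForm.toMatrix_apply, h]; rfl

theorem HasMatrix.form_inl_inr (h : m.HasMatrix e S M E) (i j : Fin 3) :
    m.form (e (.inl i)) (e (.inr j)) = M i j := by
  rw [← LinearMap.BilinForm.toMatrix_apply, h]; rfl

theorem HasMatrix.form_inr_inl (h : m.HasMatrix e S M E) (i j : Fin 3) :
    m.form (e (.inr i)) (e (.inl j)) = M j i := by
  rw [form_comm, h.form_inl_inr]

theorem HasMatrix.form_inr_inr (h : m.HasMatrix e S M E) (i j : Fin 3) :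
    m.form (e (.inr i)) (e (.inr j)) = E i j := by
  rw [← LinearMap.BilinForm.toMatrix_apply, h]; rfl

theorem HasMatrix.form_eq (h : m.HasMatrix e S M E) (x y : TStarHeis3) :
    m.form x y = ∑ i, ∑ j, (e.repr x (.inl i) * e.repr y (.inl j) * S i j
      + e.repr x (.inl i) * e.repr y (.inr j) * M i j
      + e.repr x (.inr i) * e.repr y (.inl j) * M j i
      + e.repr x (.inr i) * e.repr y (.inr j) * E i j) := by
  conv_lhs => rw [← e.sum_repr x, ← e.sum_repr y]
  simp only [Fintype.sum_sum_type, Fin.sum_univ_three, map_add, map_smul, LinearMap.add_apply,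
    LinearMap.smul_apply, smul_eq_mul, h.form_inl_inl, h.form_inl_inr, h.form_inr_inl,
    h.form_inr_inr]
  ring

theorem HasMatrix.form_inr (h : m.HasMatrix e S M E) (x : TStarHeis3) (j : Fin 3) :
    m.form x (e (.inr j)) = ∑ i, e.repr x (.inl i) * M i j + ∑ i, e.repr x (.inr i) * E i j := by
  conv_lhs => rw [← e.sum_repr x]
  simp only [Fintype.sum_sum_type, map_add, map_sum, map_smul, LinearMap.add_apply,
    LinearMap.sum_apply, LinearMap.smul_apply, smul_eq_mul, h.form_inl_inr, h.form_inr_inr]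

theorem HasMatrix.form_inl (h : m.HasMatrix e S M E) (x : TStarHeis3) (j : Fin 3) :
    m.form x (e (.inl j)) = ∑ i, e.repr x (.inl i) * S i j + ∑ i, e.repr x (.inr i) * M j i := by
  conv_lhs => rw [← e.sum_repr x]
  simp only [Fintype.sum_sum_type, map_add, map_sum, map_smul, LinearMap.add_apply,
    LinearMap.sum_apply, LinearMap.smul_apply, smul_eq_mul, h.form_inl_inl, h.form_inr_inl]

/-- If the `j`-th row of `E` vanishes, then all covariant derivatives are orthogonal to the `j`-th
central basis vector. -/
theorem HasMatrix.form_nabla_inr (he : IsAdaptedBasis e) (h : m.HasMatrix e S M E) {j : Fin 3}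
    (hj : ∀ i, E i j = 0) (x y : TStarHeis3) : m.form (m.nabla x y) (e (.inr j)) = 0 := by
  refine m.form_nabla_eq_zero (fun x => he.lie_inr_right x j) (fun x y => ?_) x y
  simp [he.lie_eq, h.form_inr_inr, hj]

open Matrix in
/-- The inverse of the matrix of the metric has the blocks `A, Cᵀ, C, D`, and its block `A`
determines the Ricci tensor. -/
theorem HasMatrix.exists_ricci_eq (he : IsAdaptedBasis e) (h : m.HasMatrix e S M E) :
    ∃ A C D : Matrix (Fin 3) (Fin 3) ℝ, A.IsSymm ∧ S * A + M * C = 1 ∧ Mᵀ * A + E * C = 0 ∧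
      C * M + D * E = 1 ∧ ∀ x y, m.ricci x y =
        -(1 / 2) * ((fun i => e.repr x (.inl i)) ⬝ᵥ mixedAdjugate A E *ᵥ fun i => e.repr y (.inl i))
        + 1 / 2 * ((fun i => m.form x (e (.inr i))) ⬝ᵥ A.adjugate *ᵥ fun i => m.form y (e (.inr i)))
        := by
  set G := LinearMap.BilinForm.toMatrix e m.form with hG
  have hu : IsUnit G.det := isUnit_iff_ne_zero.2 <|
    (LinearMap.BilinForm.nondegenerate_iff_det_ne_zero e).1 m.nondeg
  have hsymm : G.IsSymm := by
    ext i j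
    simp [hG, LinearMap.BilinForm.toMatrix_apply, m.form_comm (e i) (e j)]
  have hHG := nonsing_inv_mul G hu
  have hGH := mul_nonsing_inv G hu
  have hsymm' : G⁻¹.IsSymm := by rw [IsSymm, transpose_nonsing_inv, hsymm]
  set H := G⁻¹
  have hA : H.toBlocks₁₁.IsSymm := by ext i j; exact hsymm'.apply (.inl i) (.inl j)
  refine ⟨H.toBlocks₁₁, H.toBlocks₂₁, H.toBlocks₂₂, hA, ?_, ?_, ?_, fun x y => ?_⟩
  · rw [← fromBlocks_toBlocks H, show G = _ from h, fromBlocks_multiply, ← fromBlocks_one,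
      fromBlocks_inj] at hGH
    exact hGH.1
  · rw [← fromBlocks_toBlocks H, show G = _ from h, fromBlocks_multiply, ← fromBlocks_one,
      fromBlocks_inj] at hGH
    exact hGH.2.2.1
  · rw [← fromBlocks_toBlocks H, show G = _ from h, fromBlocks_multiply, ← fromBlocks_one,
      fromBlocks_inj] at hHG
    exact hHG.2.2.2
  · have hE : E.IsSymm := by
      ext i j
      rw [transpose_apply, ← h.form_inr_inr, ← h.form_inr_inr, form_comm]
    have hH : ∀ i j, H (.inl i) (.inl j) = H.toBlocks₁₁ i j := fun _ _ => rfl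
    rw [m.ricci_eq_sum he.lie_lie e hHG]
    -- Brackets with central basis vectors vanish, so only the block `A` of the inverse remains.
    simp only [Fintype.sum_sum_type, he.lie_inr_right, he.inr_lie, map_zero, LinearMap.zero_apply,
      mul_zero, zero_mul, Finset.sum_const_zero, add_zero, hH]
    generalize H.toBlocks₁₁ = A at hA
    rw [sub_eq_add_neg]
    congr 1
    -- Contracting `A` and `E` with two pairs of cross products gives the polarized adjugate.
    · have hA₁ := hA.apply 0 1
      have hA₂ := hA.apply 0 2
      have hA₃ := hA.apply 1 2
      have hE₁ := hE.apply 0 1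
      have hE₂ := hE.apply 0 2
      have hE₃ := hE.apply 1 2
      simp only [he.lie_eq x, he.lie_eq y, e.repr_self, map_add, map_smul, LinearMap.add_apply,
        LinearMap.smul_apply, smul_eq_mul, h.form_inr_inr, Fin.sum_univ_three, dotProduct, mulVec,
        mixedAdjugate, adjugate_fin_three, Matrix.sub_apply, Matrix.add_apply, of_apply, cons_val',
        cons_val_zero,
        cons_val_one, cons_val, cons_val_fin_one, Finsupp.single_apply, Sum.inl.injEq,
        Fin.reduceEq, if_true, if_false, hA₁, hA₂, hA₃, hE₁, hE₂, hE₃]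
      ring
    -- The `J` trace is quadratic in `A`: the structure constants assemble its `2 × 2` minors into
    -- `adj A`.
    · have hA₁ := hA.apply 0 1
      have hA₂ := hA.apply 0 2
      have hA₃ := hA.apply 1 2
      simp only [he.lie_one_two, he.lie_one_three, he.lie_two_three, he.lie_two_one, he.lie_three_one,
        he.lie_three_two, lie_self,
        map_neg, map_zero, LinearMap.neg_apply, LinearMap.zero_apply, m.form_comm (e (.inr _)),
        Fin.sum_univ_three, dotProduct, mulVec, adjugate_fin_three, of_apply, cons_val',
        cons_val_zero, cons_val_one, cons_val, cons_val_fin_one, hA₁, hA₂, hA₃]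
      ring

end LeftInvMetric

/-! ### The derived algebra and Einstein metrics -/

namespace IsAdaptedBasis

variable {e : Module.Basis (Fin 3 ⊕ Fin 3) ℝ TStarHeis3}

theorem derivedSeries_one_eq_span (he : IsAdaptedBasis e) :
    (LieAlgebra.derivedSeries ℝ TStarHeis3 1).toSubmodule
      = Submodule.span ℝ (Set.range fun i => e (.inr i)) := by
  rw [LieAlgebra.derivedSeries_def, LieAlgebra.derivedSeriesOfIdeal_succ,
    LieAlgebra.derivedSeriesOfIdeal_zero, LieSubmodule.lieIdeal_oper_eq_linear_span]
  refine le_antisymm (Submodule.span_le.2 ?_) (Submodule.span_le.2 ?_)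
  · rintro _ ⟨x, y, rfl⟩
    have hmem (i : Fin 3) : e (.inr i) ∈ Submodule.span ℝ (Set.range fun i => e (.inr i)) :=
      Submodule.subset_span ⟨i, rfl⟩
    rw [he.lie_eq]
    exact add_mem (add_mem (Submodule.smul_mem _ _ (hmem 0)) (Submodule.smul_mem _ _ (hmem 1)))
      (Submodule.smul_mem _ _ (hmem 2))
  · have hmem (i j : Fin 3) : ⁅e (.inl i), e (.inl j)⁆ ∈ Submodule.span ℝ
        {z | ∃ (x : (⊤ : LieIdeal ℝ TStarHeis3)) (y : (⊤ : LieIdeal ℝ TStarHeis3)),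
          ⁅(x : TStarHeis3), (y : TStarHeis3)⁆ = z} :=
      Submodule.subset_span ⟨⟨_, trivial⟩, ⟨_, trivial⟩, rfl⟩
    rintro _ ⟨i, rfl⟩
    fin_cases i
    · have := hmem 1 2
      rwa [he.lie_two_three] at this
    · have := hmem 2 0
      rwa [he.lie_three_one] at this
    · have := hmem 0 1
      rwa [he.lie_one_two] at this

theorem inr_mem_derivedSeries (he : IsAdaptedBasis e) (i : Fin 3) :
    e (.inr i) ∈ (LieAlgebra.derivedSeries ℝ TStarHeis3 1).toSubmodule := by
  rw [he.derivedSeries_one_eq_span]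
  exact Submodule.subset_span ⟨i, rfl⟩

end IsAdaptedBasis

namespace LeftInvMetric

open Matrix

variable {m : LeftInvMetric TStarHeis3} {e : Module.Basis (Fin 3 ⊕ Fin 3) ℝ TStarHeis3}
  {S M E : Matrix (Fin 3) (Fin 3) ℝ}

/-- A kernel vector of `E` is the coordinate vector of an element of the derived algebra orthogonal
to all of it. -/
theorem HasMatrix.det_ne_zero_of_derivedForm (he : IsAdaptedBasis e) (h : m.HasMatrix e S M E)
    (hd : m.derivedForm.Nondegenerate) : E.det ≠ 0 := by
  intro hdet
  obtain ⟨v, hv, hEv⟩ := exists_vecMul_eq_zero_iff.2 hdet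
  let u : (LieAlgebra.derivedSeries ℝ TStarHeis3 1).toSubmodule :=
    ∑ i, v i • ⟨e (.inr i), he.inr_mem_derivedSeries i⟩
  have hu : (u : TStarHeis3) = ∑ i, v i • e (.inr i) := by simp [u]
  have hu0 : u = 0 := by
    refine hd.1 u fun w => ?_
    have hw : (w : TStarHeis3) ∈ Submodule.span ℝ (Set.range fun i => e (.inr i)) := by
      rw [← he.derivedSeries_one_eq_span]; exact w.2
    change m.form u (w : TStarHeis3) = 0
    generalize (w : TStarHeis3) = w' at hw
    induction hw using Submodule.span_induction with
    | mem x hx =>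
      obtain ⟨j, rfl⟩ := hx
      simpa [hu, LinearMap.sum_apply, h.form_inr_inr, vecMul, dotProduct] using congrFun hEv j
    | zero => simp
    | add x y _ _ hx hy => rw [map_add, hx, hy, add_zero]
    | smul c x _ hx => rw [map_smul, hx, smul_zero]
  refine hv (funext fun i => ?_)
  have hr := congrArg (fun z : TStarHeis3 => e.repr z (.inr i)) hu
  simpa [hu0, Finsupp.single_apply] using hr.symm

/-- Matrix identities that follow from `ρ = c ⟨·,·⟩`. -/
theorem HasMatrix.adjugate_mul_eq (he : IsAdaptedBasis e) (h : m.HasMatrix e S M E) {c : ℝ}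
    (hc : ∀ x y, m.ricci x y = c * m.form x y) :
    ∃ A C : Matrix (Fin 3) (Fin 3) ℝ, S * A + M * C = 1 ∧ Mᵀ * A + E * C = 0 ∧
      A.adjugate * E = (2 * c) • 1 ∧
      -(1 / 2 : ℝ) • mixedAdjugate A E + (1 / 2 : ℝ) • (M * A.adjugate * Mᵀ) = c • S := by
  obtain ⟨A, C, D, hA, h₁, h₂, h₃, hric⟩ := h.exists_ricci_eq he
  have hE : Eᵀ = E := by
    ext i j
    rw [transpose_apply, ← h.form_inr_inr, ← h.form_inr_inr, form_comm]
  have hl (i : Fin 3) : (fun j => m.form (e (.inl i)) (e (.inr j))) = M i :=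
    funext fun j => h.form_inl_inr i j
  have hr (i : Fin 3) : (fun j => m.form (e (.inr i)) (e (.inr j))) = E i :=
    funext fun j => h.form_inr_inr i j
  have hl' (i : Fin 3) : (fun j => e.repr (e (.inl i)) (.inl j)) = Pi.single i 1 :=
    funext fun j => by simp [Finsupp.single_apply, Pi.single_apply, eq_comm]
  have hr' (i : Fin 3) : (fun j => e.repr (e (.inr i)) (.inl j)) = 0 :=
    funext fun j => by simp
  have hmul (P Q R : Matrix (Fin 3) (Fin 3) ℝ) (i j : Fin 3) :
      (P * Q * Rᵀ) i j = P i ⬝ᵥ Q *ᵥ R j := by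
    rw [Matrix.mul_assoc]; rfl
  -- With one argument central, the polarized-adjugate term of `ρ` drops out.
  have hME : M * A.adjugate * E = (2 * c) • M := by
    ext i j
    have := hc (e (.inl i)) (e (.inr j))
    rw [hric, hl, hr, hr', hl', ← hmul, hE, mulVec_zero, dotProduct_zero, h.form_inl_inr] at this
    rw [Matrix.smul_apply, smul_eq_mul]
    linarith
  have hEE : E * A.adjugate * E = (2 * c) • E := by
    ext i j
    have := hc (e (.inr i)) (e (.inr j))
    rw [hric, hr, hr, hr', hr', ← hmul, hE, mulVec_zero, dotProduct_zero, h.form_inr_inr] at this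
    rw [Matrix.smul_apply, smul_eq_mul]
    linarith
  refine ⟨A, C, h₁, h₂, ?_, ?_⟩
  -- The block row `(C, D)` is a left inverse of the column formed by `M` and `E`, which can thus be
  -- cancelled from `hME` and `hEE`.
  · calc A.adjugate * E = (C * M + D * E) * (A.adjugate * E) := by rw [h₃, one_mul]
      _ = C * (M * A.adjugate * E) + D * (E * A.adjugate * E) := by noncomm_ring
      _ = (2 * c) • (C * M + D * E) := by
        rw [hME, hEE, mul_smul_comm, mul_smul_comm, smul_add]
      _ = (2 * c) • 1 := by rw [h₃]
  · ext i j
    have := hc (e (.inl i)) (e (.inl j))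
    rw [hric, hl, hl, hl', hl', ← hmul, h.form_inl_inl] at this
    simpa using this

theorem not_isRicciFlat_of_derivedForm_nondegenerate (hd : m.derivedForm.Nondegenerate) :
    ¬ m.IsRicciFlat := by
  intro hflat
  obtain ⟨e, he⟩ := IsAdaptedBasis.nonempty
  obtain ⟨S, M, E, h⟩ := m.exists_blocks e
  have hdet := h.det_ne_zero_of_derivedForm he hd
  have hE : IsUnit E.det := isUnit_iff_ne_zero.2 hdet
  obtain ⟨A, C, h₁, h₂, h₄, -⟩ :=
    h.adjugate_mul_eq he (c := 0) fun x y => by rw [hflat, zero_mul]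
  have hadj : A.adjugate = 0 := by
    rw [← mul_nonsing_inv_cancel_right (A := E) A.adjugate hE, h₄]
    simp
  have hC : C = -(E⁻¹ * (Mᵀ * A)) := by
    rw [eq_neg_of_add_eq_zero_left h₂, mul_neg, neg_neg, nonsing_inv_mul_cancel_left _ _ hE]
  -- `A` inverts the Schur complement of `E`, so `A` is invertible and its adjugate cannot vanish.
  have hA : (S - M * E⁻¹ * Mᵀ) * A = 1 := by
    rw [← h₁, hC]
    noncomm_ring
  have hdetA : A.det ≠ 0 := fun h0 => by
    have := congrArg det hA
    rw [det_mul, h0, mul_zero, det_one] at this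
    exact zero_ne_one this
  have := congrFun (congrFun (mul_adjugate A) 0) 0
  rw [hadj, mul_zero] at this
  simp [hdetA.symm] at this

theorem isEinstein_iff_isRicciFlat (m : LeftInvMetric TStarHeis3) :
    m.IsEinstein ↔ m.IsRicciFlat := by
  refine ⟨fun ⟨c, hc⟩ => ?_, fun h => ⟨0, fun x y => by rw [h, zero_mul]⟩⟩
  obtain ⟨e, he⟩ := IsAdaptedBasis.nonempty
  obtain ⟨S, M, E, h⟩ := m.exists_blocks e
  obtain ⟨A, C, h₁, h₂, h₄, h₅⟩ := h.adjugate_mul_eq he hc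
  -- Multiplying the `S` block of the Einstein equation by `A` turns its right side into `c (1 - M
  -- C)`; the `M` term contributes `-c M C`, and the products `M C` cancel.
  have hmix : -(1 / 2 : ℝ) • (mixedAdjugate A E * A) = c • 1 := by
    have hMA : M * A.adjugate * Mᵀ * A = -((2 * c) • (M * C)) := by
      rw [Matrix.mul_assoc, eq_neg_of_add_eq_zero_left h₂, mul_neg, Matrix.mul_assoc,
        ← Matrix.mul_assoc _ E, h₄, smul_mul_assoc, one_mul, mul_smul_comm]
    have := congrArg (· * A) h₅
    simp only [add_mul, smul_mul_assoc, hMA] at this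
    rw [← h₁, smul_add, ← this]
    module
  have htr := congrArg trace hmix
  have hadj := congrArg trace h₄
  rw [trace_smul, trace_mixedAdjugate_mul, trace_smul, trace_one, Fintype.card_fin] at htr
  rw [trace_smul, trace_one, Fintype.card_fin] at hadj
  simp only [smul_eq_mul] at htr hadj
  rw [hadj] at htr
  -- The two traces say `-6c = 3c`.
  have hc0 : c = 0 := by push_cast at htr; linarith
  intro x y
  rw [hc, hc0, zero_mul]

/-- If the derived algebra is totally null, then the metric is flat. -/
theorem isFlat_of_derivedRank_eq_zero (h0 : m.derivedRank = 0) : m.IsFlat := by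
  obtain ⟨e, he⟩ := IsAdaptedBasis.nonempty
  obtain ⟨S, M, E, h⟩ := m.exists_blocks e
  have hD : m.derivedForm = 0 :=
    LinearMap.range_eq_bot.1 (Submodule.finrank_eq_zero.1 h0)
  have hE : E = 0 := by
    ext i j
    rw [← h.form_inr_inr]
    exact LinearMap.congr_fun (LinearMap.congr_fun hD ⟨_, he.inr_mem_derivedSeries i⟩)
      ⟨_, he.inr_mem_derivedSeries j⟩
  have hd (x y : TStarHeis3) (i : Fin 3) : m.form ⁅x, y⁆ (e (.inr i)) = 0 := by
    simp [he.lie_eq, h.form_inr_inr, hE]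
  have hn (x y : TStarHeis3) (i : Fin 3) : m.form (m.nabla x y) (e (.inr i)) = 0 :=
    m.form_nabla_eq_zero (fun x => he.lie_inr_right x i) (fun x y => hd x y i) x y
  -- Metric compatibility shows that the central basis vectors are parallel; torsion-freeness then
  -- kills derivatives along them.
  have hn₂ (x : TStarHeis3) (i : Fin 3) : m.nabla x (e (.inr i)) = 0 :=
    m.eq_zero_of_form_left fun w => by
      rw [form_nabla_left, form_comm, hn, neg_zero]
  have hn₁ (y : TStarHeis3) (i : Fin 3) : m.nabla (e (.inr i)) y = 0 := by
    have := m.nabla_sub_nabla (e (.inr i)) y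
    rwa [hn₂, sub_zero, ← lie_skew, he.lie_inr_right, neg_zero] at this
  -- The derived algebra is its own orthogonal complement: for `E = 0` the block `M` is invertible.
  have hspan (u : TStarHeis3) (hu : ∀ i, m.form u (e (.inr i)) = 0) :
      u = ∑ i, e.repr u (.inr i) • e (.inr i) := by
    obtain ⟨A, C, D, -, -, -, h₃, -⟩ := h.exists_ricci_eq he
    have hl : (fun i => e.repr u (.inl i)) = 0 := by
      rw [hE, Matrix.mul_zero, add_zero, mul_eq_one_comm] at h₃
      have hM : (fun i => e.repr u (.inl i)) ᵥ* M = 0 := by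
        funext j
        have hj := h.form_inr u j
        simp only [hu, hE, Matrix.zero_apply, mul_zero, Finset.sum_const_zero, add_zero] at hj
        exact hj.symm
      rw [← vecMul_one (fun i => e.repr u (.inl i)), ← h₃, ← vecMul_vecMul, hM, zero_vecMul]
    conv_lhs => rw [← e.sum_repr u]
    rw [Fintype.sum_sum_type, Finset.sum_eq_zero fun i _ => ?_, zero_add]
    rw [congrFun hl i, Pi.zero_apply, zero_smul]
  have hnn (w x y : TStarHeis3) : m.nabla w (m.nabla x y) = 0 := by
    rw [hspan _ (hn x y)]
    simp [hn₂]
  intro x y z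
  rw [curv_apply, hnn, hnn, he.lie_eq]
  simp [hn₁]

end LeftInvMetric

/-! ### Metrics with degenerate derived algebra -/

namespace LeftInvMetric

open Matrix

variable {m : LeftInvMetric TStarHeis3} {e : Module.Basis (Fin 3 ⊕ Fin 3) ℝ TStarHeis3}

/-- If the Ricci tensor is a multiple of the square of a parallel one-form, then it is parallel. -/
theorem isRicciParallel_of_ricci_eq {z : TStarHeis3} (hz : ∀ x y, m.form (m.nabla x y) z = 0)
    {r : ℝ} (hr : ∀ x y, m.ricci x y = r * (m.form x z * m.form y z)) : m.IsRicciParallel := by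
  intro w x y
  rw [nablaRicci, hr, hr, hz, hz]
  ring

/-- The first row and column of `A` vanish, so `ρ` is a multiple of the square of the parallel form
`⟨·, e₄⟩`. The rest of `A` inverts the lower block of `S`; multiplied by `2(ad - b²)`, the
coefficient of `ρ` becomes `1 - pa - qd`, in which `b` no longer occurs. -/
theorem isRicciParallel_and_isRicciFlat_iff_of_rank_two {a b d p q : ℝ}
    (he : IsAdaptedBasis e)
    (h : m.HasMatrix e !![0, 0, 0; 0, a, b; 0, b, d] M11 !![0, 0, 0; 0, p, 0; 0, 0, q]) :
    m.IsRicciParallel ∧ (m.IsRicciFlat ↔ p * a + q * d = 1) := by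
  obtain ⟨A, C, D, hA, h₁, h₂, -, hric⟩ := h.exists_ricci_eq he
  have hA10 := hA.apply 0 1
  have hA20 := hA.apply 0 2
  have hA21 := hA.apply 1 2
  have h00 := congrFun₂ h₂ 0 0
  have h01 := congrFun₂ h₂ 0 1
  have h02 := congrFun₂ h₂ 0 2
  have h11 := congrFun₂ h₁ 1 1
  have h12 := congrFun₂ h₁ 1 2
  have h21 := congrFun₂ h₁ 2 1
  have h22 := congrFun₂ h₁ 2 2
  simp only [Matrix.add_apply, mul_apply, Fin.sum_univ_three] at h00 h01 h02 h11 h12 h21 h22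
  simp [M11, hA21] at h00 h01 h02 h11 h12 h21 h22
  have hφ (x : TStarHeis3) : m.form x (e (.inr 0)) = e.repr x (.inl 0) := by
    rw [h.form_inr]
    simp [Fin.sum_univ_three, M11]
  have hρ (x y : TStarHeis3) : m.ricci x y =
      (1 / 2 * (A 1 1 * A 2 2 - A 1 2 * A 1 2 - (A 1 1 * q + A 2 2 * p)))
        * (m.form x (e (.inr 0)) * m.form y (e (.inr 0))) := by
    rw [hric]
    simp only [mixedAdjugate, adjugate_fin_three, mulVec, dotProduct, Fin.sum_univ_three, hφ]
    simp [h00, h01, h02, hA10, hA20, hA21]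
    ring
  refine ⟨m.isRicciParallel_of_ricci_eq (h.form_nabla_inr he fun i => by fin_cases i <;> rfl) hρ, ?_⟩
  have hdet : (a * d - b * b) * (A 1 1 * A 2 2 - A 1 2 * A 1 2) = 1 := by
    linear_combination (b * A 1 2 + d * A 2 2) * h11 - (b * A 1 1 + d * A 1 2) * h12 + h22
  have hA11 : (a * d - b * b) * A 1 1 = d := by linear_combination d * h11 - b * h21
  have hA22 : (a * d - b * b) * A 2 2 = a := by linear_combination a * h22 - b * h12
  have hΔ : a * d - b * b ≠ 0 := left_ne_zero_of_mul_eq_one hdet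
  constructor
  · intro hf
    have := hf (e (.inl 0)) (e (.inl 0))
    rw [hρ, hφ, e.repr_self, Finsupp.single_eq_same, mul_one, mul_one] at this
    linear_combination -2 * (a * d - b * b) * this + hdet - q * hA11 - p * hA22
  · intro hpq x y
    rw [hρ, mul_eq_zero]
    refine Or.inl (mul_left_cancel₀ hΔ ?_)
    linear_combination (1 / 2) * (hdet - q * hA11 - p * hA22 - hpq)

/-! ### Derived algebra of rank 1. -/

section RankOne

variable {a b c d ε η : ℝ}

/-- Invertibility of the upper `2 × 2` block of `M` leaves only the last diagonal entry of `A`, as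
in `E`. All adjugates in the formula for `ρ` are then zero. -/
theorem isRicciFlat_of_rank_one (he : IsAdaptedBasis e)
    (h : m.HasMatrix e !![0, 0, 0; 0, 0, 0; 0, 0, ε] !![a, b, 0; c, d, 0; 0, 0, 0]
      !![0, 0, 0; 0, 0, 0; 0, 0, η]) : a * d - b * c ≠ 0 ∧ m.IsRicciFlat := by
  obtain ⟨A, C, D, hA, h₁, h₂, -, hric⟩ := h.exists_ricci_eq he
  have hdet : (a * d - b * c) * (C 0 0 * C 1 1 - C 0 1 * C 1 0) = 1 := by
    have h00 := congrFun₂ h₁ 0 0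
    have h01 := congrFun₂ h₁ 0 1
    have h10 := congrFun₂ h₁ 1 0
    have h11 := congrFun₂ h₁ 1 1
    simp only [Matrix.add_apply, mul_apply, Fin.sum_univ_three] at h00 h01 h10 h11
    simp at h00 h01 h10 h11
    linear_combination (c * C 0 1 + d * C 1 1) * h00 - (c * C 0 0 + d * C 1 0) * h01 + h11
  have hΔ := left_ne_zero_of_mul_eq_one hdet
  have h₀ (j : Fin 3) : A 0 j = 0 ∧ A 1 j = 0 := by
    have h0 := congrFun₂ h₂ 0 j
    have h1 := congrFun₂ h₂ 1 j
    simp only [Matrix.add_apply, mul_apply, Fin.sum_univ_three] at h0 h1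
    simp at h0 h1
    constructor <;> refine mul_left_cancel₀ hΔ ?_
    · linear_combination d * h0 - c * h1
    · linear_combination a * h1 - b * h0
  refine ⟨hΔ, fun x y => ?_⟩
  rw [hric]
  have hA20 := (hA.apply 0 2).trans (h₀ 2).1
  have hA21 := (hA.apply 1 2).trans (h₀ 2).2
  simp only [mixedAdjugate, adjugate_fin_three, mulVec, dotProduct, Fin.sum_univ_three]
  simp [(h₀ _).1, (h₀ _).2, hA20, hA21]

/-- Covariant derivatives are orthogonal to `e₄` and `e₅`, hence have no `e₁, e₂` components, and
their inner products involve only `e₃` and `e₆`. The number `(a - d)² + 4bc` is the discriminant of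
the characteristic polynomial of the upper block of `M`. -/
theorem form_curv_of_rank_one (hε : ε ^ 2 = 1) (hη : η ^ 2 = 1) (he : IsAdaptedBasis e)
    (h : m.HasMatrix e !![0, 0, 0; 0, 0, 0; 0, 0, ε] !![a, b, 0; c, d, 0; 0, 0, 0]
      !![0, 0, 0; 0, 0, 0; 0, 0, η]) :
    (∀ x y i, i = 0 ∨ i = 1 → e.repr (m.nabla x y) (.inl i) = 0) ∧
    ∀ x y z w, m.form (m.curv x y z) w = (3 * η - ε * ((a - d) ^ 2 + 4 * b * c)) / 4
      * (e.repr x (.inl 0) * e.repr y (.inl 1) - e.repr x (.inl 1) * e.repr y (.inl 0))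
      * (e.repr z (.inl 0) * e.repr w (.inl 1) - e.repr z (.inl 1) * e.repr w (.inl 0)) := by
  have hΔ := (isRicciFlat_of_rank_one he h).1
  have hn (x y : TStarHeis3) :
      e.repr (m.nabla x y) (.inl 0) = 0 ∧ e.repr (m.nabla x y) (.inl 1) = 0 := by
    have h0 := h.form_nabla_inr he (j := 0) (fun i => by fin_cases i <;> rfl) x y
    have h1 := h.form_nabla_inr he (j := 1) (fun i => by fin_cases i <;> rfl) x y
    rw [h.form_inr] at h0 h1
    simp [Fin.sum_univ_three] at h0 h1
    constructor <;> refine mul_left_cancel₀ hΔ ?_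
    · linear_combination d * h0 - c * h1
    · linear_combination a * h1 - b * h0
  -- Since `ε` and `η` are their own inverses, the `e₃, e₆` coordinates are recovered from pairings
  -- with `e₃` and `e₆`.
  have hform (x y z w : TStarHeis3) : m.form (m.nabla x y) (m.nabla z w)
      = ε * (m.form (m.nabla x y) (e (.inl 2)) * m.form (m.nabla z w) (e (.inl 2)))
      + η * (m.form (m.nabla x y) (e (.inr 2)) * m.form (m.nabla z w) (e (.inr 2))) := by
    rw [h.form_eq, h.form_inl, h.form_inl, h.form_inr, h.form_inr]
    simp [Fin.sum_univ_three, hn]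
    linear_combination
      -(e.repr (m.nabla x y) (.inl 2) * e.repr (m.nabla z w) (.inl 2) * ε) * hε
      - (e.repr (m.nabla x y) (.inr 2) * e.repr (m.nabla z w) (.inr 2) * η) * hη
  have hα (x y : TStarHeis3) : m.form (m.nabla x y) (e (.inl 2)) =
      b * e.repr x (.inl 0) * e.repr y (.inl 0) - c * e.repr x (.inl 1) * e.repr y (.inl 1)
      - (a - d) / 2
        * (e.repr x (.inl 0) * e.repr y (.inl 1) + e.repr x (.inl 1) * e.repr y (.inl 0)) := by
    have := m.two_mul_form_nabla x y (e (.inl 2))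
    simp only [he.form_lie, h.form_inr, Fin.sum_univ_three, e.repr_self] at this
    simp at this
    linear_combination this / 2
  have hβ (x y : TStarHeis3) : m.form (m.nabla x y) (e (.inr 2)) = η / 2
      * (e.repr x (.inl 0) * e.repr y (.inl 1) - e.repr x (.inl 1) * e.repr y (.inl 0)) := by
    have := m.two_mul_form_nabla x y (e (.inr 2))
    rw [he.form_lie m x y] at this
    simp only [h.form_inr_inr, he.lie_inr_right, he.lie_inr_left, map_zero,
      LinearMap.zero_apply] at this
    simp at this
    linear_combination this / 2
  have hγ (x y z w : TStarHeis3) : m.form (m.nabla ⁅x, y⁆ z) w = -(η / 2)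
      * (e.repr x (.inl 0) * e.repr y (.inl 1) - e.repr x (.inl 1) * e.repr y (.inl 0))
      * (e.repr z (.inl 0) * e.repr w (.inl 1) - e.repr z (.inl 1) * e.repr w (.inl 0)) := by
    have := m.two_mul_form_nabla ⁅x, y⁆ z w
    simp only [he.form_lie, he.repr_lie_inl, h.form_inr_inr] at this
    simp at this
    linear_combination this / 2
  refine ⟨fun x y i hi => ?_, fun x y z w => ?_⟩
  · rcases hi with rfl | rfl
    exacts [(hn x y).1, (hn x y).2]
  · rw [form_curv, hform, hform, hγ]
    -- By the Plücker relation, the symmetric form in `hα` contributes `ε` times its determinant,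
    -- `hβ` contributes `η³/4 = η/4`, and `hγ` the remaining `η/2`.
    simp only [hα, hβ]
    linear_combination (η / 4
      * (e.repr x (.inl 0) * e.repr y (.inl 1) - e.repr x (.inl 1) * e.repr y (.inl 0))
      * (e.repr z (.inl 0) * e.repr w (.inl 1) - e.repr z (.inl 1) * e.repr w (.inl 0))) * hη

/-- The curvature tensor is a multiple of the square of a parallel two-form. -/
theorem isLocallySymmetric_of_rank_one (hε : ε ^ 2 = 1) (hη : η ^ 2 = 1) (he : IsAdaptedBasis e)
    (h : m.HasMatrix e !![0, 0, 0; 0, 0, 0; 0, 0, ε] !![a, b, 0; c, d, 0; 0, 0, 0]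
      !![0, 0, 0; 0, 0, 0; 0, 0, η]) : m.IsLocallySymmetric := by
  obtain ⟨hn, hR⟩ := form_curv_of_rank_one hε hη he h
  intro w x y z
  refine m.eq_zero_of_form_left fun v => ?_
  simp only [nablaCurv, map_sub, LinearMap.sub_apply, form_nabla_left, hR, hn _ _ 0 (.inl rfl),
    hn _ _ 1 (.inr rfl)]
  ring

theorem isFlat_iff_of_rank_one (hε : ε ^ 2 = 1) (hη : η ^ 2 = 1) (he : IsAdaptedBasis e)
    (h : m.HasMatrix e !![0, 0, 0; 0, 0, 0; 0, 0, ε] !![a, b, 0; c, d, 0; 0, 0, 0]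
      !![0, 0, 0; 0, 0, 0; 0, 0, η]) : m.IsFlat ↔ ε * ((a - d) ^ 2 + 4 * b * c) = 3 * η := by
  obtain ⟨-, hR⟩ := form_curv_of_rank_one hε hη he h
  constructor
  · intro hf
    have := hR (e (.inl 0)) (e (.inl 1)) (e (.inl 0)) (e (.inl 1))
    rw [hf] at this
    simp [e.repr_self] at this
    linear_combination 4 * this
  · intro hk x y z
    refine m.eq_zero_of_form_left fun w => ?_
    rw [hR, hk]
    ring

end RankOne

/-- Here `A` has rank 1, so `adj A = 0`, but its middle diagonal entry `ε` pairs with the entry `η`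
of `E` in the polarized adjugate. This leaves a nonzero multiple of the square of the parallel form
`⟨·, e₅⟩`. -/
theorem isRicciParallel_and_not_isRicciFlat_of_rank_one {lam ε η : ℝ} (hε : ε ^ 2 = 1)
    (hη : η ^ 2 = 1) (he : IsAdaptedBasis e)
    (h : m.HasMatrix e !![0, 0, 0; 0, 0, 0; 0, 0, ε] !![0, lam, 0; 1, 0, 0; 1, 0, 0]
      !![0, 0, 0; 0, 0, 0; 0, 0, η]) : m.IsRicciParallel ∧ ¬ m.IsRicciFlat := by
  obtain ⟨A, C, D, hA, h₁, h₂, -, hric⟩ := h.exists_ricci_eq he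
  have hlam : lam ≠ 0 := by
    have := congrFun₂ h₁ 0 0
    simp only [Matrix.add_apply, mul_apply, Fin.sum_univ_three] at this
    simp at this
    exact left_ne_zero_of_mul_eq_one this
  have h0 (j : Fin 3) : A 0 j = 0 := by
    have := congrFun₂ h₂ 1 j
    simp only [Matrix.add_apply, mul_apply, Fin.sum_univ_three] at this
    simp [hlam] at this
    exact this
  have h2 (j : Fin 3) : A 2 j = ε * ((1 : Matrix (Fin 3) (Fin 3) ℝ) 2 j
      - (1 : Matrix (Fin 3) (Fin 3) ℝ) 1 j) := by
    have k1 := congrFun₂ h₁ 1 j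
    have k2 := congrFun₂ h₁ 2 j
    simp only [Matrix.add_apply, mul_apply, Fin.sum_univ_three] at k1 k2
    simp at k1 k2
    linear_combination -A 2 j * hε + ε * k2 - ε * k1
  have h1 (j : Fin 3) : A 1 j = -A 2 j := by
    have := congrFun₂ h₂ 0 j
    simp only [Matrix.add_apply, mul_apply, Fin.sum_univ_three] at this
    simp at this
    linear_combination this
  have hφ (x : TStarHeis3) : m.form x (e (.inr 1)) = e.repr x (.inl 0) * lam := by
    rw [h.form_inr]
    simp [Fin.sum_univ_three]
  have hρ (x y : TStarHeis3) : m.ricci x y =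
      -(ε * η) / (2 * lam ^ 2) * (m.form x (e (.inr 1)) * m.form y (e (.inr 1))) := by
    rw [hric]
    simp only [mixedAdjugate, adjugate_fin_three, mulVec, dotProduct, Fin.sum_univ_three, hφ]
    simp [h0, h1, h2]
    field_simp
    ring
  refine ⟨m.isRicciParallel_of_ricci_eq (h.form_nabla_inr he fun i => by fin_cases i <;> rfl) hρ,
    fun hf => ?_⟩
  have hε0 : ε ≠ 0 := by rintro rfl; norm_num at hε
  have hη0 : η ≠ 0 := by rintro rfl; norm_num at hη
  have := hf (e (.inl 0)) (e (.inl 0))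
  rw [hρ, hφ] at this
  simp [hlam, hε0, hη0] at this

end LeftInvMetric

/-! ### The families of metrics as special cases. -/

theorem proposition4p2 :
    -- nondegenerate derived algebra
    (∀ m : LeftInvMetric TStarHeis3, m.derivedForm.Nondegenerate → ¬ m.IsFlat ∧ ¬ m.IsRicciFlat) ∧
    -- derived algebra of rank 2
    (∀ (m : LeftInvMetric TStarHeis3) (e : Module.Basis (Fin 3 ⊕ Fin 3) ℝ TStarHeis3),
      IsAdaptedBasis e →
      (∀ ε s₂₂ s₃₃ : ℝ, ε = 1 ∨ ε = -1 →
        m.HasMatrix e !![0, 0, 0; 0, s₂₂, 0; 0, 0, s₃₃] M11 (ε • E20) →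
        m.IsRicciParallel ∧ (m.IsRicciFlat ↔ s₃₃ = ε - s₂₂)) ∧
      (∀ s₂₂ s₃₃ : ℝ,
        m.HasMatrix e !![0, 0, 0; 0, s₂₂, 0; 0, 0, s₃₃] M11 E11 →
        m.IsRicciParallel ∧ (m.IsRicciFlat ↔ s₃₃ = -1 + s₂₂)) ∧
      (∀ s₂₂ : ℝ,
        m.HasMatrix e !![0, 0, 0; 0, s₂₂, |s₂₂| / 2; 0, |s₂₂| / 2, 0] M11 E11 →
        m.IsRicciParallel ∧ (m.IsRicciFlat ↔ s₂₂ = 1)) ∧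
      (∀ s₃₃ : ℝ,
        m.HasMatrix e !![0, 0, 0; 0, 0, |s₃₃| / 2; 0, |s₃₃| / 2, s₃₃] M11 E11 →
        m.IsRicciParallel ∧ (m.IsRicciFlat ↔ s₃₃ = -1))) ∧
    -- derived algebra of rank 1
    (∀ (m : LeftInvMetric TStarHeis3) (e : Module.Basis (Fin 3 ⊕ Fin 3) ℝ TStarHeis3),
      IsAdaptedBasis e → ∀ ε η : ℝ, ε = 1 ∨ ε = -1 → η = 1 ∨ η = -1 →
      (∀ m₁₁ m₂₂ : ℝ,
        m.HasMatrix e (ε • E10) !![m₁₁, 0, 0; 0, m₂₂, 0; 0, 0, 0] (η • E10) →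
        m.IsLocallySymmetric ∧ m.IsRicciFlat ∧
        (m.IsFlat ↔ ε = η ∧ (m₁₁ = m₂₂ + √3 ∨ m₁₁ = m₂₂ - √3))) ∧
      (∀ m₁₁ m₁₂ : ℝ,
        m.HasMatrix e (ε • E10) !![m₁₁, m₁₂, 0; -m₁₂, m₁₁, 0; 0, 0, 0] (η • E10) →
        m.IsLocallySymmetric ∧ m.IsRicciFlat ∧
        (m.IsFlat ↔ ε = -η ∧ (m₁₂ = -(√3 / 2) ∨ m₁₂ = √3 / 2))) ∧
      (∀ m₁₁ : ℝ,
        m.HasMatrix e (ε • E10) !![m₁₁, 0, 0; 1, m₁₁, 0; 0, 0, 0] (η • E10) →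
        m.IsLocallySymmetric ∧ m.IsRicciFlat ∧ ¬ m.IsFlat) ∧
      (∀ lam : ℝ,
        m.HasMatrix e (ε • E10) !![0, lam, 0; 1, 0, 0; 1, 0, 0] (η • E10) →
        m.IsRicciParallel ∧ ¬ m.IsRicciFlat)) ∧
    -- totally null derived algebra
    (∀ m : LeftInvMetric TStarHeis3, m.derivedRank = 0 → m.IsFlat) ∧
    -- Einstein metrics
    (∀ m : LeftInvMetric TStarHeis3, m.IsEinstein ↔ m.IsRicciFlat) := by
  have hsq {t : ℝ} (ht : t = 1 ∨ t = -1) : t ^ 2 = 1 := by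
    rcases ht with rfl | rfl <;> norm_num
  have hE20 (t : ℝ) : t • E20 = !![0, 0, 0; 0, t, 0; 0, 0, t] := by simp [E20]
  have hE10 (t : ℝ) : t • E10 = !![0, 0, 0; 0, 0, 0; 0, 0, t] := by simp [E10]
  refine ⟨fun m hm => ?_, fun m e he => ⟨fun ε s₂₂ s₃₃ hε h => ?_, fun s₂₂ s₃₃ h => ?_,
    fun s₂₂ h => ?_, fun s₃₃ h => ?_⟩, fun m e he ε η hε hη => ⟨fun m₁₁ m₂₂ h => ?_,
    fun m₁₁ m₁₂ h => ?_, fun m₁₁ h => ?_, fun lam h => ?_⟩,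
    fun m hm => LeftInvMetric.isFlat_of_derivedRank_eq_zero hm,
    LeftInvMetric.isEinstein_iff_isRicciFlat⟩
  · have := LeftInvMetric.not_isRicciFlat_of_derivedForm_nondegenerate hm
    exact ⟨fun hf => this hf.isRicciFlat, this⟩
  · rw [hE20] at h
    obtain ⟨h₁, h₂⟩ := LeftInvMetric.isRicciParallel_and_isRicciFlat_iff_of_rank_two he h
    refine ⟨h₁, h₂.trans ?_⟩
    rcases hε with rfl | rfl <;> constructor <;> intro <;> linarith
  · obtain ⟨h₁, h₂⟩ := LeftInvMetric.isRicciParallel_and_isRicciFlat_iff_of_rank_two he h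
    exact ⟨h₁, h₂.trans ⟨fun _ => by linarith, fun _ => by linarith⟩⟩
  · obtain ⟨h₁, h₂⟩ := LeftInvMetric.isRicciParallel_and_isRicciFlat_iff_of_rank_two he h
    exact ⟨h₁, h₂.trans ⟨fun _ => by linarith, fun _ => by linarith⟩⟩
  · obtain ⟨h₁, h₂⟩ := LeftInvMetric.isRicciParallel_and_isRicciFlat_iff_of_rank_two he h
    exact ⟨h₁, h₂.trans ⟨fun _ => by linarith, fun _ => by linarith⟩⟩
  all_goals rw [hE10, hE10] at h
  · refine ⟨LeftInvMetric.isLocallySymmetric_of_rank_one (hsq hε) (hsq hη) he h,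
      (LeftInvMetric.isRicciFlat_of_rank_one he h).2,
      (LeftInvMetric.isFlat_iff_of_rank_one (hsq hε) (hsq hη) he h).trans ?_⟩
    have h3 : √3 ^ 2 = (3 : ℝ) := Real.sq_sqrt (by norm_num)
    have hsub : (m₁₁ = m₂₂ + √3 ∨ m₁₁ = m₂₂ - √3) ↔ (m₁₁ - m₂₂) ^ 2 = 3 := by
      rw [show (m₁₁ - m₂₂) ^ 2 = 3 ↔ (m₁₁ - m₂₂) ^ 2 = √3 ^ 2 by rw [h3],
        sq_eq_sq_iff_eq_or_eq_neg, sub_eq_iff_eq_add', sub_eq_iff_eq_add',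
        ← sub_eq_add_neg]
    rw [hsub]
    constructor
    -- The discriminant is now a square, so opposite signs of `ε` and `η` are impossible.
    · intro hk
      rcases hε with rfl | rfl <;> rcases hη with rfl | rfl
      · exact ⟨rfl, by linarith⟩
      · nlinarith [sq_nonneg (m₁₁ - m₂₂)]
      · nlinarith [sq_nonneg (m₁₁ - m₂₂)]
      · exact ⟨rfl, by linarith⟩
    · rintro ⟨rfl, hk⟩
      linear_combination ε * hk
  · refine ⟨LeftInvMetric.isLocallySymmetric_of_rank_one (hsq hε) (hsq hη) he h,
      (LeftInvMetric.isRicciFlat_of_rank_one he h).2,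
      (LeftInvMetric.isFlat_iff_of_rank_one (hsq hε) (hsq hη) he h).trans ?_⟩
    have h3 : (√3 / 2) ^ 2 = (3 / 4 : ℝ) := by
      rw [div_pow, Real.sq_sqrt (by norm_num)]; norm_num
    rw [or_comm, ← sq_eq_sq_iff_eq_or_eq_neg, h3]
    constructor
    -- The discriminant is `-4 m₁₂²`, so equal signs are impossible.
    · intro hk
      rcases hε with rfl | rfl <;> rcases hη with rfl | rfl
      · nlinarith [sq_nonneg m₁₂]
      · exact ⟨by norm_num, by linarith⟩
      · exact ⟨rfl, by linarith⟩
      · nlinarith [sq_nonneg m₁₂]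
    · rintro ⟨rfl, hk⟩
      linear_combination 4 * η * hk
  · refine ⟨LeftInvMetric.isLocallySymmetric_of_rank_one (hsq hε) (hsq hη) he h,
      (LeftInvMetric.isRicciFlat_of_rank_one he h).2, fun hf => ?_⟩
    have := (LeftInvMetric.isFlat_iff_of_rank_one (hsq hε) (hsq hη) he h).1 hf
    -- For a Jordan block the discriminant is zero, while flatness would require it to be `±3`.
    rcases hη with rfl | rfl <;> norm_num at this
  · exact LeftInvMetric.isRicciParallel_and_not_isRicciFlat_of_rank_one (hsq hε) (hsq hη) he h
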